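/- For positive integers $a\le b$ let $[a,b]=\{a,a+1,\dots,b\}$ and $[a]=[1,a]$, and let $\binom{X}{k}$ be the family of all $k$-subsets of $X$. A family of sets is intersecting if no two of its members are disjoint. For integers $0<k\le n<2k<m$, an $(m,n,k)$-intersecting family is an intersecting family $\mathcal F$ with $\binom{[n]}{k}\subseteq\mathcal F\subseteq\binom{[m]}{k}$; let $\alpha(m,n,k)$ be the maximum cardinality of such a family, and call an $(m,n,k)$-intersecting family maximum if it has $\alpha(m,n,k)$ members. Put $$h(m,n,k)=\binom{n}{k}+\sum_{i=1}^{2k-n-1}\binom{n-1}{k-i-1}\binom{m-n}{i}$$ and, for $t\in[n]$, $$\mathcal H_t=\binom{[n]}{k}\cup\bigcup_{i=1}^{2k-n-1}\left\{A\cup B\cup\{t\} : A\in\binom{[n]\setminus\{t\}}{k-i-1},\ B\in\binom{[n+1,m]}{i}\right\}.$$ Theorem. Let $m,n,k$ be integers with $0<k\le n<2k<m$ and $n=2k-3$. Then $\alpha(m,n,k)=h(m,n,k)$, and every maximum $(m,n,k)$-intersecting family equals $\mathcal H_t$ for some $t\in[n]$. -/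

import Mathlib

open Finset

/-- An `(m,n,k)`-intersecting family: an intersecting family `F` of `k`-subsets of
`[m] = {1, …, m}` that contains every `k`-subset of `[n] = {1, …, n}`. -/
def IsMNKIntersecting (m n k : ℕ) (F : Finset (Finset ℕ)) : Prop :=
  powersetCard k (Icc 1 n) ⊆ F ∧ F ⊆ powersetCard k (Icc 1 m) ∧
    (F : Set (Finset ℕ)).Intersecting

open Classical in
/-- `α(m,n,k)`: the maximum cardinality of an `(m,n,k)`-intersecting family.
The maximum runs over the finitely many families of `k`-subsets of `[m]`; for
`0 < k ≤ n < 2k ≤ m` at least one of them is `(m,n,k)`-intersecting. -/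
noncomputable def mnkAlpha (m n k : ℕ) : ℕ :=
  ((powersetCard k (Icc 1 m)).powerset.filter (IsMNKIntersecting m n k)).sup card

/-- A maximum `(m,n,k)`-intersecting family: one of cardinality `α(m,n,k)`. -/
def IsMaximumMNK (m n k : ℕ) (F : Finset (Finset ℕ)) : Prop :=
  IsMNKIntersecting m n k F ∧ F.card = mnkAlpha m n k

/-- The family `H_t^{m,n,k}`: all `k`-subsets of `[n]`, together with all sets `A ∪ B ∪ {t}` where,
for some `1 ≤ i ≤ 2k-n-1`, `A` is a `(k-i-1)`-subset of `[n] \ {t}` and `B` is an `i`-subset of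
`[n+1,m]`. (For `0 < k ≤ n < 2k` none of the subtractions truncates.) -/
def mnkH (m n k t : ℕ) : Finset (Finset ℕ) :=
  powersetCard k (Icc 1 n) ∪
    (Icc 1 (2 * k - n - 1)).biUnion fun i =>
      image₂ (fun A B => A ∪ B ∪ {t})
        (powersetCard (k - i - 1) (Icc 1 n \ {t})) (powersetCard i (Icc (n + 1) m))

/-- The number `h(m,n,k)`. -/
def mnkh (m n k : ℕ) : ℕ :=
  n.choose k + ∑ i ∈ Icc 1 (2 * k - n - 1), (n - 1).choose (k - i - 1) * (m - n).choose i

/-! Write `n = 2s+1`, `k = s+2`, `U = [n]`, `V = [n+1,m]`, so that `|V| ≥ 4`. Every member of `F`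
meets every `(s+2)`-subset of `U`, so its trace on `U` has at least `s` elements. Traces of size
`s+2` contribute at most `C(n,s+2)`. Each trace `A` of size `s` is paired with its complement `U \
A` of size `s+1`: the link of `A` is a graph on `V`, the link of `U \ A` is a set of vertices of `V`
lying on every edge of that graph, and the weight of `A` is the sum of their sizes.

Disjoint `s`-sets have cross-intersecting graphs, and then one of the two weights is at most `|V|`
(`card_add_card_le_of_cross_intersecting`). Hence the heavy sets, those of weight above `|V|`, form
an intersecting family, and Erdős–Ko–Rado bounds their number by `C(2s,s-1)`. A heavy set weighs at
most `C(|V|,2) > |V|`, so the total is at most `h`.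

Equality forces `C(2s,s-1)` heavy sets with complete graphs. By uniqueness in Erdős–Ko–Rado
(`intersecting_powersetCard_odd`) they form a star with some centre `t`. The complete graphs then
exclude every member that leaves `U` and avoids `t`, whence `F ⊆ H_t`. -/

/-! ### The Erdős–Ko–Rado theorem for `s`-subsets of a `(2s+1)`-set, with uniqueness -/

section Cycle

variable {s : ℕ}

/-- The element `s` of `ℤ/(2s+1)`; steps by it turn `ℤ/(2s+1)` into an odd cycle. -/
def cycleStep (s : ℕ) : Fin (2 * s + 1) := ⟨s, by omega⟩

theorem val_add_cycleStep (i : Fin (2 * s + 1)) :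
    (i + cycleStep s).val = if i.val ≤ s then i.val + s else i.val - s - 1 := by
  have h := Fin.val_add_eq_ite i (cycleStep s)
  have hs : (cycleStep s).val = s := rfl
  rw [hs] at h
  rw [h]
  have := i.isLt
  split_ifs <;> omega

theorem card_add_card_image_add_cycleStep {M : Finset (Fin (2 * s + 1))}
    (hM : ∀ i ∈ M, i + cycleStep s ∉ M) :
    #(M ∪ M.map (Equiv.addRight (cycleStep s)).toEmbedding) = 2 * #M := by
  rw [card_union_of_disjoint, card_map]
  · ring
  rw [disjoint_right]
  intro a ha
  obtain ⟨i, hi, rfl⟩ := mem_map.1 ha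
  exact hM i hi

theorem card_le_of_cycle_independent {M : Finset (Fin (2 * s + 1))}
    (hM : ∀ i ∈ M, i + cycleStep s ∉ M) : #M ≤ s := by
  have h := card_le_univ (M ∪ M.map (Equiv.addRight (cycleStep s)).toEmbedding)
  rw [card_add_card_image_add_cycleStep hM, Fintype.card_fin] at h
  omega

/-- `M` and its shift are disjoint and cover `2s` of the `2s+1` points; the single uncovered point
gives the gap. -/
theorem existsUnique_gap_of_cycle_independent {M : Finset (Fin (2 * s + 1))}
    (hM : ∀ i ∈ M, i + cycleStep s ∉ M) (hc : #M = s) :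
    ∃! i, i ∉ M ∧ i + cycleStep s ∉ M := by
  have h := card_compl (M ∪ M.map (Equiv.addRight (cycleStep s)).toEmbedding)
  rw [card_add_card_image_add_cycleStep hM, Fintype.card_fin, hc,
    show 2 * s + 1 - 2 * s = 1 by omega, card_eq_one] at h
  obtain ⟨b, hb⟩ := h
  have key : ∀ i, (i ∉ M ∧ i + cycleStep s ∉ M) ↔ i + cycleStep s = b := by
    intro i
    rw [← mem_singleton, ← hb]
    simp only [mem_compl, mem_union, mem_map, Equiv.coe_toEmbedding, Equiv.coe_addRight,
      add_left_inj, exists_eq_right, not_or]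
    tauto
  refine ⟨b - cycleStep s, (key _).2 (by simp), fun i hi => ?_⟩
  rw [← (key i).1 hi]; simp

/-- Away from its unique gap, `M` alternates along the odd cycle. Two steps by `s` amount to `-1`,
so absence passes from `i+1` to `i`, starting at `s` and going down to `0`. -/
theorem notMem_of_cycle_gap_zero {M : Finset (Fin (2 * s + 1))}
    (hM : ∀ i ∈ M, i + cycleStep s ∉ M) (hc : #M = s)
    (h0 : 0 ∉ M) (hs : cycleStep s ∉ M) (i : Fin (2 * s + 1)) (hi : i.val ≤ s) : i ∉ M := by
  obtain ⟨b, -, hu⟩ := existsUnique_gap_of_cycle_independent hM hc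
  have hb : b = 0 := (hu 0 ⟨h0, by simpa using hs⟩).symm
  have hgap : ∀ i : Fin (2 * s + 1), i ∉ M → i.val ≠ 0 → i + cycleStep s ∈ M := by
    intro i hi h
    by_contra hcon
    have := hu i ⟨hi, hcon⟩
    rw [hb] at this
    exact h (by simp [this])
  suffices H : ∀ d (i : Fin (2 * s + 1)), i.val + d = s → i ∉ M from H (s - i.val) i (by omega)
  intro d
  induction d with
  | zero =>
    intro i hi
    have : i = cycleStep s := Fin.ext (by simpa [cycleStep] using hi)
    rwa [this]
  | succ d ih =>
    intro i hi
    have h1 := ih ⟨i.val + 1, by omega⟩ (by simp; omega)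
    have h2 := hM _ (hgap _ h1 (by simp))
    convert h2 using 2
    apply Fin.ext
    rw [val_add_cycleStep, val_add_cycleStep]
    simp only
    split_ifs <;> omega

/-- The arc of `s` consecutive elements of `ℤ/(2s+1)` starting at `i`. -/
def cycleArc (i : Fin (2 * s + 1)) : Finset (Fin (2 * s + 1)) :=
  univ.filter fun v => (v - i).val < s

theorem mem_cycleArc {i v : Fin (2 * s + 1)} : v ∈ cycleArc i ↔ (v - i).val < s := by
  simp [cycleArc]

theorem mem_cycleArc_of_le {i v : Fin (2 * s + 1)} (hi : i.val ≤ s) :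
    v ∈ cycleArc i ↔ i.val ≤ v.val ∧ v.val < s + i.val := by
  rw [mem_cycleArc]
  rcases le_or_gt i v with h | h
  · rw [Fin.coe_sub_iff_le.2 h]
    have : i.val ≤ v.val := h
    omega
  · rw [Fin.coe_sub_iff_lt.2 h]
    have : v.val < i.val := h
    omega

theorem cycleArc_eq_map (i : Fin (2 * s + 1)) :
    cycleArc i = (cycleArc 0).map (Equiv.addRight i).toEmbedding := by
  ext v
  rw [mem_map_equiv, mem_cycleArc, mem_cycleArc, Equiv.addRight_symm, Equiv.coe_addRight, sub_zero,
    sub_eq_add_neg]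

theorem card_cycleArc (i : Fin (2 * s + 1)) : #(cycleArc i) = s := by
  rw [cycleArc_eq_map, card_map]
  have : cycleArc (0 : Fin (2 * s + 1)) = Finset.Iio (cycleStep s) := by
    ext v
    rw [mem_cycleArc_of_le (by simp)]
    simp [cycleStep, Fin.lt_def]
  rw [this, Fin.card_Iio]; rfl

theorem disjoint_cycleArc (i : Fin (2 * s + 1)) :
    Disjoint (cycleArc i) (cycleArc (i + cycleStep s)) := by
  rw [disjoint_left]
  intro v hv hv'
  rw [mem_cycleArc] at hv hv'
  have h : v - i = (v - (i + cycleStep s)) + cycleStep s := by abel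
  rw [h, val_add_cycleStep] at hv
  split_ifs at hv <;> omega

theorem exists_perm_sorting {n : ℕ} (g : Fin n → ℕ) :
    ∃ e : Equiv.Perm (Fin n), ∀ c v, g (e v) ≤ c ↔ v.val < #{x | g x ≤ c} := by
  refine ⟨Tuple.sort g, fun c v => ?_⟩
  have h := Tuple.lt_card_le_iff_apply_le_of_monotone (f := g ∘ Tuple.sort g) (a := c)
    (j := v) (Tuple.monotone_sort g)
  rw [← Function.comp_apply (f := g), ← h]
  have : #{x | (g ∘ Tuple.sort g) x ≤ c} = #{x | g x ≤ c} := by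
    rw [← card_map (Tuple.sort g).toEmbedding]
    congr 1
    ext x
    simp [mem_map_equiv]
  rw [this]

theorem exists_perm_map_cycleArc_eq {A : Finset (Fin (2 * s + 1))} (hA : #A = s) :
    ∃ e : Equiv.Perm (Fin (2 * s + 1)), (cycleArc 0).map e.toEmbedding = A := by
  obtain ⟨e, he⟩ := exists_perm_sorting fun x => if x ∈ A then 0 else 1
  refine ⟨e, ?_⟩
  ext x
  obtain ⟨v, rfl⟩ := e.surjective x
  have h := he 0 v
  have hc : #{x | (if x ∈ A then 0 else 1) ≤ 0} = s := by
    refine Eq.trans ?_ hA; congr 1; ext x; by_cases hx : x ∈ A <;> simp [hx]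
  rw [hc] at h
  rw [mem_map_equiv, Equiv.symm_apply_apply, mem_cycleArc, sub_zero, ← h]
  by_cases hx : e v ∈ A <;> simp [hx]

theorem exists_perm_map_three_cycleArcs {X Y W : Finset (Fin (2 * s + 1))} (hX : #X = s)
    (hY : #Y = s) (hW : #W = s) (hXY : Disjoint X Y) (hWXY : W ⊆ X ∪ Y) :
    ∃ (e : Equiv.Perm (Fin (2 * s + 1))) (i : Fin (2 * s + 1)), i.val ≤ s ∧
      (cycleArc 0).map e.toEmbedding = X ∧ (cycleArc (cycleStep s)).map e.toEmbedding = Y ∧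
      (cycleArc i).map e.toEmbedding = W := by
  -- Sorting by `g` lists `X \ W`, `X ∩ W`, `Y ∩ W`, `Y \ W` and then the leftover point, so `X`,
  -- `Y`, `W` become intervals starting at `0`, `s` and `|X \ W|`.
  set g : Fin (2 * s + 1) → ℕ := fun x =>
    if x ∈ X then (if x ∈ W then 1 else 0) else
      if x ∈ Y then (if x ∈ W then 2 else 3) else 4 with hg
  have hd : ∀ x, x ∈ X → x ∉ Y := fun x hx hy => disjoint_left.1 hXY hx hy
  have hw : ∀ x, x ∈ W → x ∈ X ∨ x ∈ Y := fun x hx => mem_union.1 (hWXY hx)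
  obtain ⟨e, he⟩ := exists_perm_sorting g
  have hj : #(X \ W) ≤ s := (card_le_card sdiff_subset).trans hX.le
  have h0 : #{x | g x ≤ 0} = #(X \ W) := by
    congr 1; ext x
    by_cases hx : x ∈ X <;> by_cases hy : x ∈ Y <;> by_cases hz : x ∈ W <;> simp [hg, hx, hy, hz]
  have h1 : #{x | g x ≤ 1} = s := by
    refine Eq.trans ?_ hX; congr 1; ext x
    by_cases hx : x ∈ X <;> by_cases hy : x ∈ Y <;> by_cases hz : x ∈ W <;> simp [hg, hx, hy, hz]
  have h2 : #{x | g x ≤ 2} = s + #(X \ W) := by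
    have : #(X ∪ W) = s + #(X \ W) := by
      rw [← sdiff_union_self_eq_union, card_union_of_disjoint sdiff_disjoint, hW, add_comm]
    rw [← this]; congr 1; ext x
    have := hw x
    by_cases hx : x ∈ X <;> by_cases hy : x ∈ Y <;> by_cases hz : x ∈ W <;>
      simp [hg, hx, hy, hz] <;> tauto
  have h3 : #{x | g x ≤ 3} = s + s := by
    have : #(X ∪ Y) = s + s := by rw [card_union_of_disjoint hXY, hX, hY]
    rw [← this]; congr 1; ext x
    by_cases hx : x ∈ X <;> by_cases hy : x ∈ Y <;> by_cases hz : x ∈ W <;> simp [hg, hx, hy, hz]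
  refine ⟨e, ⟨#(X \ W), by omega⟩, hj, ?_, ?_, ?_⟩ <;> ext x <;>
    obtain ⟨v, rfl⟩ := e.surjective x <;>
    rw [mem_map_equiv, Equiv.symm_apply_apply]
  · rw [mem_cycleArc_of_le (by simp)]
    have := he 1 v
    rw [h1] at this
    have hd := hd (e v)
    have hw := hw (e v)
    simp only [Fin.val_zero, zero_le, true_and, add_zero, ← this]
    by_cases hx : e v ∈ X <;> by_cases hy : e v ∈ Y <;> by_cases hz : e v ∈ W <;>
      simp [hg, hx, hy, hz]
  · rw [mem_cycleArc_of_le (by simp [cycleStep])]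
    have a1 := he 1 v
    have a3 := he 3 v
    rw [h1] at a1
    rw [h3] at a3
    have hd := hd (e v)
    have hw := hw (e v)
    simp only [cycleStep, ← a3, ← not_lt, ← a1]
    by_cases hx : e v ∈ X <;> by_cases hy : e v ∈ Y <;> by_cases hz : e v ∈ W <;>
      simp [hg, hx, hy, hz] <;> tauto
  · rw [mem_cycleArc_of_le hj]
    have a0 := he 0 v
    have a2 := he 2 v
    rw [h0] at a0
    rw [h2] at a2
    have hd := hd (e v)
    have hw := hw (e v)
    simp only [← a2, ← not_lt, ← a0]
    by_cases hx : e v ∈ X <;> by_cases hy : e v ∈ Y <;> by_cases hz : e v ∈ W <;>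
      simp [hg, hx, hy, hz] <;> tauto

/-- The starting points of the arcs that the numbering `e` sends to members of `J`. -/
def arcStarts (J : Finset (Finset (Fin (2 * s + 1)))) (e : Equiv.Perm (Fin (2 * s + 1))) :
    Finset (Fin (2 * s + 1)) :=
  univ.filter fun i => (cycleArc i).map e.toEmbedding ∈ J

theorem arcStarts_independent {J : Finset (Finset (Fin (2 * s + 1)))}
    (hJ : (J : Set (Finset (Fin (2 * s + 1)))).Intersecting) (e : Equiv.Perm (Fin (2 * s + 1))) :
    ∀ i ∈ arcStarts J e, i + cycleStep s ∉ arcStarts J e := by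
  intro i hi hi'
  simp only [arcStarts, mem_filter, mem_univ, true_and] at hi hi'
  exact hJ hi hi' ((disjoint_map _).2 (disjoint_cycleArc i))

/-- Katona's double count: `c` is the number of permutations carrying the standard arc to a given
`s`-set. It does not depend on the set, and by rotation it does not depend on the arc either. -/
theorem exists_sum_card_arcStarts (s : ℕ) : ∃ c, 0 < c ∧
    Fintype.card (Equiv.Perm (Fin (2 * s + 1))) = c * (2 * s + 1).choose s ∧
    ∀ J ⊆ powersetCard s (univ : Finset (Fin (2 * s + 1))),
      ∑ e, #(arcStarts J e) = (2 * s + 1) * (c * #J) := by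
  set f : Equiv.Perm (Fin (2 * s + 1)) → Finset (Fin (2 * s + 1)) :=
    fun e => (cycleArc 0).map e.toEmbedding with hf
  have hfib : ∀ A : Finset (Fin (2 * s + 1)), #A = s →
      #{e | f e = A} = #{e | f e = cycleArc 0} := by
    intro A hA
    obtain ⟨p, hp⟩ := exists_perm_map_cycleArc_eq hA
    symm
    refine card_bij (fun e _ => e.trans p) ?_ ?_ ?_
    · intro e he
      simp only [mem_filter, mem_univ, true_and, hf] at he ⊢
      have h := map_map e.toEmbedding p.toEmbedding (cycleArc 0)
      rw [he, hp] at h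
      exact h.symm
    · intro e _ e' _ h
      refine Equiv.ext fun x => ?_
      have := congrArg (fun q => q x) h
      simpa using this
    · intro e he
      refine ⟨e.trans p.symm, ?_, by ext; simp⟩
      simp only [mem_filter, mem_univ, true_and, hf] at he ⊢
      rw [← hp] at he
      ext x
      have := congrArg (fun q => p x ∈ q) he
      simp only [mem_map_equiv, Equiv.symm_apply_apply] at this
      rw [mem_map_equiv, ← this]
      rfl
  have hcount : ∀ J ⊆ powersetCard s (univ : Finset (Fin (2 * s + 1))),
      #{e | f e ∈ J} = #{e | f e = cycleArc 0} * #J := by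
    intro J hJ
    rw [card_eq_sum_card_fiberwise (f := f) (t := J) (by intro e he; simpa using he),
      mul_comm _ #J]
    refine sum_const_nat fun A hA => ?_
    rw [← hfib A (mem_powersetCard.1 (hJ hA)).2, filter_filter]
    congr 1; ext e
    simp only [mem_filter, mem_univ, true_and]
    constructor
    · exact fun h => h.2
    · rintro rfl; exact ⟨hA, rfl⟩
  refine ⟨#{e | f e = cycleArc 0}, ?_, ?_, ?_⟩
  · refine card_pos.2 ⟨1, ?_⟩
    simp only [mem_filter, mem_univ, true_and, hf]
    exact map_refl
  · have := hcount _ subset_rfl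
    rw [card_powersetCard, card_univ, Fintype.card_fin] at this
    rw [← this, ← card_univ]
    congr 1; ext e
    simp [hf, mem_powersetCard, card_cycleArc]
  · intro J hJ
    have h1 : ∀ i : Fin (2 * s + 1),
        #{e : Equiv.Perm (Fin (2 * s + 1)) | (cycleArc i).map e.toEmbedding ∈ J} =
          #{e | f e ∈ J} := by
      intro i
      refine card_bij (fun e _ => (Equiv.addRight i).trans e) ?_ ?_ ?_
      · intro e he
        simp only [mem_filter, mem_univ, true_and, hf] at he ⊢
        rw [cycleArc_eq_map, map_map] at he
        exact he
      · intro e _ e' _ h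
        refine Equiv.ext fun x => ?_
        have := congrArg (fun q => q (x - i)) h
        simpa using this
      · intro e he
        refine ⟨(Equiv.addRight i).symm.trans e, ?_, by ext; simp⟩
        simp only [mem_filter, mem_univ, true_and, hf] at he ⊢
        rw [cycleArc_eq_map, map_map]
        convert he using 2
        ext; simp
    simp only [arcStarts, card_filter]
    rw [sum_comm]
    simp only [← card_filter, h1, hcount J hJ]
    simp

/-! ### Averaging over all numberings, and the case of equality -/

theorem succ_mul_choose_pred (hs : 0 < s) :
    (2 * s + 1) * (2 * s).choose (s - 1) = s * (2 * s + 1).choose s := by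
  obtain ⟨r, rfl⟩ : ∃ r, s = r + 1 := ⟨s - 1, by omega⟩
  have := Nat.add_one_mul_choose_eq (2 * (r + 1)) r
  simp only [Nat.add_sub_cancel]
  rw [this, mul_comm]

theorem card_le_of_intersecting_fin (hs : 0 < s) {J : Finset (Finset (Fin (2 * s + 1)))}
    (hJs : J ⊆ powersetCard s univ) (hJ : (J : Set (Finset (Fin (2 * s + 1)))).Intersecting) :
    #J ≤ (2 * s).choose (s - 1) := by
  obtain ⟨c, hc, hcard, hsum⟩ := exists_sum_card_arcStarts s
  have h : ∑ e, #(arcStarts J e) ≤ ∑ _e : Equiv.Perm (Fin (2 * s + 1)), s :=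
    sum_le_sum fun e _ => card_le_of_cycle_independent (arcStarts_independent hJ e)
  rw [hsum J hJs, sum_const, card_univ, hcard, smul_eq_mul] at h
  have h2 := succ_mul_choose_pred hs
  have : ((2 * s + 1) * c) * #J ≤ ((2 * s + 1) * c) * (2 * s).choose (s - 1) := by
    calc ((2 * s + 1) * c) * #J = (2 * s + 1) * (c * #J) := by ring
      _ ≤ c * (2 * s + 1).choose s * s := h
      _ = c * (s * (2 * s + 1).choose s) := by ring
      _ = ((2 * s + 1) * c) * (2 * s).choose (s - 1) := by rw [← h2]; ring
  exact Nat.le_of_mul_le_mul_left this (by positivity)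

theorem card_arcStarts_eq (hs : 0 < s) {J : Finset (Finset (Fin (2 * s + 1)))}
    (hJs : J ⊆ powersetCard s univ) (hJ : (J : Set (Finset (Fin (2 * s + 1)))).Intersecting)
    (hcJ : #J = (2 * s).choose (s - 1)) (e : Equiv.Perm (Fin (2 * s + 1))) :
    #(arcStarts J e) = s := by
  obtain ⟨c, hc, hcard, hsum⟩ := exists_sum_card_arcStarts s
  have h : ∑ e, #(arcStarts J e) = ∑ _e : Equiv.Perm (Fin (2 * s + 1)), s := by
    rw [hsum J hJs, sum_const, card_univ, hcard, smul_eq_mul, hcJ]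
    have h2 := succ_mul_choose_pred hs
    calc _ = c * ((2 * s + 1) * (2 * s).choose (s - 1)) := by ring
      _ = _ := by rw [h2]; ring
  exact (sum_eq_sum_iff_of_le
    fun e _ => card_le_of_cycle_independent (arcStarts_independent hJ e)).1 h e (mem_univ _)

/-- At equality every numbering has exactly `s` arcs in `J`. The gap of one numbering gives two
disjoint `s`-sets outside `J` that miss a single point `p`. A member of `J` avoiding `p` would lie
in their union. Renumbering makes the two sets the arcs at `0` and `s` and the member an arc between
them, which `notMem_of_cycle_gap_zero` forbids. -/
theorem exists_mem_of_intersecting_fin (hs : 0 < s) {J : Finset (Finset (Fin (2 * s + 1)))}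
    (hJs : J ⊆ powersetCard s univ) (hJ : (J : Set (Finset (Fin (2 * s + 1)))).Intersecting)
    (hcJ : #J = (2 * s).choose (s - 1)) : ∃ p, ∀ A ∈ J, p ∈ A := by
  have hnot : ∀ e i, i ∉ arcStarts J e ↔ (cycleArc i).map e.toEmbedding ∉ J := by
    intro e i; simp [arcStarts]
  obtain ⟨i, hi, -⟩ := existsUnique_gap_of_cycle_independent
    (arcStarts_independent hJ (Equiv.refl _)) (card_arcStarts_eq hs hJs hJ hcJ _)
  rw [hnot, hnot] at hi
  simp only [Equiv.refl_toEmbedding, map_refl] at hi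
  have hdis := disjoint_cycleArc i
  have hcU : #(cycleArc i ∪ cycleArc (i + cycleStep s)) = 2 * s := by
    rw [card_union_of_disjoint hdis, card_cycleArc, card_cycleArc, two_mul]
  have hcompl := card_compl (cycleArc i ∪ cycleArc (i + cycleStep s))
  rw [hcU, Fintype.card_fin, show 2 * s + 1 - 2 * s = 1 by omega, card_eq_one] at hcompl
  obtain ⟨p, hp⟩ := hcompl
  refine ⟨p, fun A hA => ?_⟩
  by_contra hpA
  have hAs : #A = s := (mem_powersetCard.1 (hJs hA)).2
  have hsub : A ⊆ cycleArc i ∪ cycleArc (i + cycleStep s) := by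
    intro x hx
    by_contra hcon
    rw [← mem_compl, hp, mem_singleton] at hcon
    exact hpA (hcon ▸ hx)
  obtain ⟨e, j, hj, h0, h1, h2⟩ := exists_perm_map_three_cycleArcs (card_cycleArc i)
    (card_cycleArc (i + cycleStep s)) hAs hdis hsub
  refine (hnot e j).1 (notMem_of_cycle_gap_zero (arcStarts_independent hJ e)
    (card_arcStarts_eq hs hJs hJ hcJ e) ?_ ?_ j hj) (h2 ▸ hA)
  · rw [hnot, h0]; exact hi.1
  · rw [hnot, h1]; exact hi.2

end Cycle

/-! ### Transport to an arbitrary set of size `2s+1` -/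

section Transfer

variable {α : Type*} [DecidableEq α]

theorem intersecting_powersetCard_odd {s : ℕ} (hs : 0 < s) {U : Finset α} (hU : #U = 2 * s + 1)
    {J : Finset (Finset α)} (hJs : J ⊆ powersetCard s U)
    (hJ : (J : Set (Finset α)).Intersecting) :
    #J ≤ (2 * s).choose (s - 1) ∧
      (#J = (2 * s).choose (s - 1) → ∃ p ∈ U, ∀ A ∈ J, p ∈ A) := by
  obtain ⟨φ, hφ⟩ : ∃ φ : Fin (2 * s + 1) ↪ α, univ.map φ = U := by
    have e := (U.equivFinOfCardEq hU).symm
    refine ⟨e.toEmbedding.trans (Function.Embedding.subtype _), ?_⟩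
    ext x
    simp only [mem_map, mem_univ, true_and]
    constructor
    · rintro ⟨i, rfl⟩; exact (e i).2
    · intro hx; exact ⟨e.symm ⟨x, hx⟩, by simp⟩
  set K : Finset (Finset (Fin (2 * s + 1))) := univ.filter fun A => A.map φ ∈ J with hK
  have hmem : ∀ A, A ∈ K ↔ A.map φ ∈ J := fun A => by simp [hK]
  have himg : K.map (mapEmbedding φ).toEmbedding = J := by
    ext A
    simp only [mem_map, hmem]
    constructor
    · rintro ⟨B, hB, rfl⟩; exact hB
    · intro hA
      obtain ⟨B, -, rfl⟩ := subset_map_iff.1 (hφ ▸ (mem_powersetCard.1 (hJs hA)).1)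
      exact ⟨B, hA, rfl⟩
  have hcard : #K = #J := by rw [← himg, card_map]
  have hKs : K ⊆ powersetCard s univ := by
    intro A hA
    have := (mem_powersetCard.1 (hJs ((hmem A).1 hA))).2
    rw [card_map] at this
    exact mem_powersetCard.2 ⟨subset_univ _, this⟩
  have hKi : (K : Set (Finset (Fin (2 * s + 1)))).Intersecting := by
    intro A hA B hB hAB
    exact hJ ((hmem A).1 hA) ((hmem B).1 hB) ((disjoint_map φ).2 hAB)
  refine ⟨hcard ▸ card_le_of_intersecting_fin hs hKs hKi, fun h => ?_⟩
  obtain ⟨p, hp⟩ := exists_mem_of_intersecting_fin hs hKs hKi (hcard.trans h)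
  refine ⟨φ p, hφ ▸ mem_map_of_mem φ (mem_univ p), fun A hA => ?_⟩
  rw [← himg, mem_map] at hA
  obtain ⟨B, hB, rfl⟩ := hA
  exact mem_map_of_mem φ (hp B hB)

end Transfer

/-! ### Graphs on a vertex set of size at least four -/

section Graphs

theorem eq_empty_of_disjoint_pairs {α : Type*} {V : Finset α} {E G : Finset (Finset α)}
    (hG : G ⊆ powersetCard 1 V) (hEG : ∀ e ∈ E, ∀ g ∈ G, ¬ Disjoint e g)
    (hI : ¬ ∀ e ∈ E, ∀ f ∈ E, ¬ Disjoint e f) : G = ∅ := by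
  push Not at hI
  obtain ⟨e, he, f, hf, hef⟩ := hI
  rw [eq_empty_iff_forall_notMem]
  intro g hg
  obtain ⟨x, rfl⟩ := card_eq_one.1 (mem_powersetCard.1 (hG hg)).2
  have a1 := hEG e he _ hg
  have a2 := hEG f hf _ hg
  simp only [disjoint_singleton_right, not_not] at a1 a2
  exact disjoint_left.1 hef a1 a2

variable {α : Type*} [DecidableEq α]

theorem card_le_of_forall_mem_pair {V : Finset α} {E : Finset (Finset α)}
    (hE : E ⊆ powersetCard 2 V) {x : α} (hx : ∀ e ∈ E, x ∈ e) : #E + 1 ≤ #V ∨ E = ∅ := by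
  rcases E.eq_empty_or_nonempty with h | ⟨e, he⟩
  · exact Or.inr h
  · left
    have hxV : x ∈ V := (mem_powersetCard.1 (hE he)).1 (hx e he)
    have hsub : E ⊆ (V.erase x).image fun y => {x, y} := by
      intro f hf
      obtain ⟨hfV, hf2⟩ := mem_powersetCard.1 (hE hf)
      obtain ⟨a, b, hab, rfl⟩ := card_eq_two.1 hf2
      have := hx _ hf
      simp only [mem_insert, mem_singleton] at this
      simp only [insert_subset_iff, singleton_subset_iff] at hfV
      simp only [mem_image, mem_erase]
      rcases this with rfl | rfl
      · exact ⟨b, ⟨hab.symm, hfV.2⟩, rfl⟩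
      · exact ⟨a, ⟨hab, hfV.1⟩, pair_comm _ _⟩
    have h1 := (card_le_card hsub).trans card_image_le
    rw [card_erase_of_mem hxV] at h1
    have := card_pos.2 ⟨x, hxV⟩
    omega

theorem card_le_three_or_exists_mem_of_intersecting_pairs {V : Finset α} {E : Finset (Finset α)}
    (hE : E ⊆ powersetCard 2 V) (hI : ∀ e ∈ E, ∀ f ∈ E, ¬ Disjoint e f) :
    #E ≤ 3 ∨ ∃ x, ∀ e ∈ E, x ∈ e := by
  rcases E.eq_empty_or_nonempty with rfl | ⟨e, he⟩
  · simp
  obtain ⟨a, b, hab, rfl⟩ := card_eq_two.1 (mem_powersetCard.1 (hE he)).2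
  by_cases ha : ∀ e ∈ E, a ∈ e
  · exact Or.inr ⟨a, ha⟩
  by_cases hb : ∀ e ∈ E, b ∈ e
  · exact Or.inr ⟨b, hb⟩
  left
  push Not at ha hb
  obtain ⟨f, hf, haf⟩ := ha
  obtain ⟨g, hg, hbg⟩ := hb
  have hpair : ∀ d ∈ E, ∀ x y, x ≠ y → x ∈ d → y ∈ d → {x, y} = d := fun d hd x y hxy hx hy =>
    eq_of_subset_of_card_le (insert_subset hx (singleton_subset_iff.2 hy))
      (by rw [(mem_powersetCard.1 (hE hd)).2, card_pair hxy])
  have hmeet : ∀ x y, ∀ d ∈ E, ¬ Disjoint {x, y} d → x ∈ d ∨ y ∈ d := by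
    intro x y d _ h
    simpa only [disjoint_insert_left, disjoint_singleton_left, not_and_or, not_not] using h
  have hbf : b ∈ f := (hmeet a b f hf (hI _ he _ hf)).resolve_left haf
  have hag : a ∈ g := (hmeet a b g hg (hI _ he _ hg)).resolve_right hbg
  obtain ⟨c, hcf, hcg⟩ := not_disjoint_iff.1 (hI _ hf _ hg)
  have hca : a ≠ c := by rintro rfl; exact haf hcf
  have hcb : b ≠ c := by rintro rfl; exact hbg hcg
  have hf' := hpair f hf b c hcb hbf hcf
  have hg' := hpair g hg a c hca hag hcg
  -- With no common vertex, the edges `ab`, `bc`, `ac` form a triangle, and an edge meeting all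
  -- three is one of them.
  have hsub : E ⊆ {{a, b}, f, g} := by
    intro d hd
    simp only [mem_insert, mem_singleton]
    have e1 := hmeet a b d hd (hI _ he _ hd)
    have e2 := hmeet b c d hd (hf' ▸ hI _ hf _ hd)
    have e3 := hmeet a c d hd (hg' ▸ hI _ hg _ hd)
    have p1 := hpair d hd a b hab
    have p2 := hpair d hd b c hcb
    have p3 := hpair d hd a c hca
    rw [hf'] at p2
    rw [hg'] at p3
    tauto
  exact (card_le_card hsub).trans card_le_three

/-- A graph `E` whose edges pairwise meet, together with vertices lying on every edge of `E`. -/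
theorem card_add_card_le_of_intersecting {V : Finset α} (hV : 4 ≤ #V)
    {E G : Finset (Finset α)} (hE : E ⊆ powersetCard 2 V) (hG : G ⊆ powersetCard 1 V)
    (hEG : ∀ e ∈ E, ∀ g ∈ G, ¬ Disjoint e g) (hI : ∀ e ∈ E, ∀ f ∈ E, ¬ Disjoint e f) :
    #E + #G ≤ #V := by
  rcases E.eq_empty_or_nonempty with rfl | ⟨e, he⟩
  · have := card_le_card hG
    rw [card_powersetCard, Nat.choose_one_right] at this
    simpa using this
  have hGe : G ⊆ e.image fun x => {x} := by
    intro g hg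
    obtain ⟨x, rfl⟩ := card_eq_one.1 (mem_powersetCard.1 (hG hg)).2
    have := hEG e he _ hg
    simp only [disjoint_singleton_right, not_not] at this
    exact mem_image_of_mem _ this
  have hG2 : #G ≤ 2 := by
    have := (card_le_card hGe).trans card_image_le
    rwa [(mem_powersetCard.1 (hE he)).2] at this
  -- Two vertices in `G` determine the only edge. One vertex makes `E` a star with at most `|V| - 1`
  -- edges. With none, `E` is a star or has at most three edges.
  rcases Nat.lt_or_ge 1 #G with h1 | h1
  · obtain ⟨g, hg, g', hg', hne⟩ := one_lt_card.1 h1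
    have hEs : E ⊆ {g ∪ g'} := by
      intro f hf
      rw [mem_singleton]
      have a1 := hEG f hf g hg
      have a2 := hEG f hf g' hg'
      obtain ⟨x, rfl⟩ := card_eq_one.1 (mem_powersetCard.1 (hG hg)).2
      obtain ⟨y, rfl⟩ := card_eq_one.1 (mem_powersetCard.1 (hG hg')).2
      simp only [disjoint_singleton_right, not_not] at a1 a2
      symm
      apply eq_of_subset_of_card_le
      · exact union_subset (singleton_subset_iff.2 a1) (singleton_subset_iff.2 a2)
      · rw [(mem_powersetCard.1 (hE hf)).2, card_union_of_disjoint]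
        · simp
        · simpa using fun h => hne (by rw [h])
    have := card_le_card hEs
    rw [card_singleton] at this
    omega
  · rcases Nat.eq_zero_or_pos #G with h0 | h0
    · rcases card_le_three_or_exists_mem_of_intersecting_pairs hE hI with h3 | ⟨x, hx⟩
      · omega
      · rcases card_le_of_forall_mem_pair hE hx with h | h
        · omega
        · rw [h] at he; simp at he
    · obtain ⟨g, hg⟩ := card_pos.1 h0
      obtain ⟨x, rfl⟩ := card_eq_one.1 (mem_powersetCard.1 (hG hg)).2
      have hx : ∀ f ∈ E, x ∈ f := fun f hf => by simpa using hEG f hf _ hg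
      rcases card_le_of_forall_mem_pair hE hx with h | h
      · omega
      · rw [h] at he; simp at he

/-- If neither graph is intersecting, no vertex lies on all edges of `E'`, so `G'` is empty. Each
edge of `E'` joins the two ends of a disjoint pair of edges of `E`, which leaves at most `2 * 2 ≤
|V|` edges. -/
theorem card_add_card_le_of_cross_intersecting {V : Finset α} (hV : 4 ≤ #V)
    {E E' G G' : Finset (Finset α)} (hE : E ⊆ powersetCard 2 V) (hE' : E' ⊆ powersetCard 2 V)
    (hG : G ⊆ powersetCard 1 V) (hG' : G' ⊆ powersetCard 1 V)
    (hEG : ∀ e ∈ E, ∀ g ∈ G, ¬ Disjoint e g) (hEG' : ∀ e ∈ E', ∀ g ∈ G', ¬ Disjoint e g)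
    (hEE' : ∀ e ∈ E, ∀ f ∈ E', ¬ Disjoint e f) :
    #E + #G ≤ #V ∨ #E' + #G' ≤ #V := by
  by_cases hI : ∀ e ∈ E, ∀ f ∈ E, ¬ Disjoint e f
  · exact Or.inl (card_add_card_le_of_intersecting hV hE hG hEG hI)
  right
  by_cases hI' : ∀ e ∈ E', ∀ f ∈ E', ¬ Disjoint e f
  · exact card_add_card_le_of_intersecting hV hE' hG' hEG' hI'
  rw [eq_empty_of_disjoint_pairs hG' hEG' hI', card_empty, add_zero]
  push Not at hI
  obtain ⟨e, he, f, hf, hef⟩ := hI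
  have hsub : E' ⊆ image₂ (fun x y => {x, y}) e f := by
    intro d hd
    have a1 := hEE' e he d hd
    have a2 := hEE' f hf d hd
    rw [not_disjoint_iff] at a1 a2
    obtain ⟨x, hxe, hxd⟩ := a1
    obtain ⟨y, hyf, hyd⟩ := a2
    have hxy : x ≠ y := fun h => disjoint_left.1 hef hxe (h ▸ hyf)
    refine mem_image₂.2 ⟨x, hxe, y, hyf, ?_⟩
    apply eq_of_subset_of_card_le
    · simp [insert_subset_iff, hxd, hyd]
    · rw [(mem_powersetCard.1 (hE' hd)).2, card_pair hxy]
  have := (card_le_card hsub).trans (card_image₂_le _ _ _)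
  rw [(mem_powersetCard.1 (hE he)).2, (mem_powersetCard.1 (hE hf)).2] at this
  omega

theorem eq_empty_of_cross_intersecting_powersetCard {V : Finset α} (hV : 4 ≤ #V)
    {E : Finset (Finset α)} (hE : E ⊆ powersetCard 2 V)
    (hcross : ∀ e ∈ E, ∀ f ∈ powersetCard 2 V, ¬ Disjoint e f) : E = ∅ := by
  rw [eq_empty_iff_forall_notMem]
  intro e he
  obtain ⟨heV, he2⟩ := mem_powersetCard.1 (hE he)
  have : 2 ≤ #(V \ e) := by rw [card_sdiff_of_subset heV]; omega
  obtain ⟨f, hf, hf2⟩ := exists_subset_card_eq this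
  exact hcross e he f (mem_powersetCard.2 ⟨hf.trans sdiff_subset, hf2⟩)
    (disjoint_sdiff.mono_right hf)

theorem lt_choose_two {N : ℕ} (h : 4 ≤ N) : N < N.choose 2 := by
  obtain ⟨r, rfl⟩ : ∃ r, N = r + 4 := ⟨N - 4, by omega⟩
  have h1 : (r + 4).choose 2 * 2 = (r + 4) * (r + 3) := by
    have := Nat.add_one_mul_choose_eq (r + 3) 1
    rw [Nat.choose_one_right] at this
    exact this.symm
  nlinarith

end Graphs

/-! ### Links of traces -/

section Link

variable {α : Type*} [DecidableEq α]

/-- The parts outside `U` of the members of `F` whose trace on `U` is `A`. -/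
def traceLink (F : Finset (Finset α)) (U A : Finset α) : Finset (Finset α) :=
  (F.filter fun f => f ∩ U = A).image fun f => f \ U

theorem mem_traceLink {F : Finset (Finset α)} {U A e : Finset α} :
    e ∈ traceLink F U A ↔ ∃ f ∈ F, f ∩ U = A ∧ f \ U = e := by
  simp [traceLink, and_assoc]

theorem card_eq_sum_traceLink (F : Finset (Finset α)) (U : Finset α) :
    #F = ∑ A ∈ U.powerset, #(traceLink F U A) := by
  rw [card_eq_sum_card_fiberwise (f := fun f => f ∩ U) (t := U.powerset)
    (fun f _ => by simp)]
  refine sum_congr rfl fun A _ => ?_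
  rw [traceLink, card_image_of_injOn]
  intro f hf g hg hfg
  simp only [coe_filter, Set.mem_ofPred_eq] at hf hg hfg
  rw [← sdiff_union_inter f U, ← sdiff_union_inter g U, hfg, hf.2, hg.2]

theorem not_disjoint_of_mem_traceLink {F : Finset (Finset α)}
    (hF : (F : Set (Finset α)).Intersecting) {U A B e f : Finset α} (hAB : Disjoint A B)
    (he : e ∈ traceLink F U A) (hf : f ∈ traceLink F U B) : ¬ Disjoint e f := by
  obtain ⟨p, hp, rfl, rfl⟩ := mem_traceLink.1 he
  obtain ⟨q, hq, rfl, rfl⟩ := mem_traceLink.1 hf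
  intro hd
  refine hF hp hq ?_
  rw [disjoint_left] at hAB hd ⊢
  intro x hx hx'
  by_cases hU : x ∈ U
  · exact hAB (mem_inter.2 ⟨hx, hU⟩) (mem_inter.2 ⟨hx', hU⟩)
  · exact hd (mem_sdiff.2 ⟨hx, hU⟩) (mem_sdiff.2 ⟨hx', hU⟩)

theorem sum_powersetCard_sdiff {U : Finset α} {a b : ℕ} (hU : #U = a + b) (g : Finset α → ℕ) :
    ∑ B ∈ powersetCard b U, g B = ∑ A ∈ powersetCard a U, g (U \ A) := by
  refine sum_nbij' (fun B => U \ B) (fun A => U \ A) ?_ ?_ ?_ ?_ ?_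
  · intro B hB
    rw [mem_powersetCard] at hB ⊢
    exact ⟨sdiff_subset, by rw [card_sdiff_of_subset hB.1]; omega⟩
  · intro B hB
    rw [mem_powersetCard] at hB ⊢
    exact ⟨sdiff_subset, by rw [card_sdiff_of_subset hB.1]; omega⟩
  · intro B hB
    exact Finset.sdiff_sdiff_eq_self (mem_powersetCard.1 hB).1
  · intro B hB
    exact Finset.sdiff_sdiff_eq_self (mem_powersetCard.1 hB).1
  · intro B hB
    rw [Finset.sdiff_sdiff_eq_self (mem_powersetCard.1 hB).1]

end Link

/-! ### Families containing all `(s+2)`-subsets of `[2s+1]` -/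

section Families

variable {m s : ℕ} {F : Finset (Finset ℕ)}

theorem card_Icc_one_odd (s : ℕ) : #(Icc 1 (2 * s + 1)) = 2 * s + 1 := by simp

/-- Otherwise `U` would contain `s+2` points outside `f`, forming a member of `F` disjoint from `f`.
-/
theorem le_card_inter_of_mem (hF : IsMNKIntersecting m (2 * s + 1) (s + 2) F) {f : Finset ℕ}
    (hf : f ∈ F) : s ≤ #(f ∩ Icc 1 (2 * s + 1)) := by
  by_contra hlt
  have h1 : s + 2 ≤ #(Icc 1 (2 * s + 1) \ f) := by
    rw [card_sdiff, card_Icc_one_odd]; omega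
  obtain ⟨g, hg, hgc⟩ := exists_subset_card_eq h1
  refine hF.2.2 hf (hF.1 (mem_powersetCard.2 ⟨hg.trans sdiff_subset, hgc⟩)) ?_
  exact disjoint_sdiff.mono_right hg

theorem traceLink_subset (hF : IsMNKIntersecting m (2 * s + 1) (s + 2) F) {A : Finset ℕ} {c : ℕ}
    (hA : #A + c = s + 2) :
    traceLink F (Icc 1 (2 * s + 1)) A ⊆ powersetCard c (Icc (2 * s + 1 + 1) m) := by
  intro e he
  obtain ⟨f, hf, rfl, rfl⟩ := mem_traceLink.1 he
  obtain ⟨hfm, hfc⟩ := mem_powersetCard.1 (hF.2.1 hf)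
  rw [mem_powersetCard]
  constructor
  · intro x hx
    rw [mem_sdiff] at hx
    have := hfm hx.1
    have h2 := hx.2
    simp only [mem_Icc] at *
    omega
  · have := card_sdiff_add_card_inter f (Icc 1 (2 * s + 1))
    omega

theorem traceLink_eq_empty (hF : IsMNKIntersecting m (2 * s + 1) (s + 2) F) {A : Finset ℕ}
    (hA : #A < s ∨ s + 2 < #A) : traceLink F (Icc 1 (2 * s + 1)) A = ∅ := by
  rw [eq_empty_iff_forall_notMem]
  intro e he
  obtain ⟨f, hf, rfl, rfl⟩ := mem_traceLink.1 he
  have h1 := le_card_inter_of_mem hF hf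
  have h2 := card_le_card (inter_subset_left (s₁ := f) (s₂ := Icc 1 (2 * s + 1)))
  rw [(mem_powersetCard.1 (hF.2.1 hf)).2] at h2
  omega

/-- The number of members of `F` whose trace on `[2s+1]` is `A` or its complement. -/
def traceWeight (F : Finset (Finset ℕ)) (s : ℕ) (A : Finset ℕ) : ℕ :=
  #(traceLink F (Icc 1 (2 * s + 1)) A) +
    #(traceLink F (Icc 1 (2 * s + 1)) (Icc 1 (2 * s + 1) \ A))

theorem card_le_add_sum_traceWeight (hF : IsMNKIntersecting m (2 * s + 1) (s + 2) F) :
    #F ≤ (2 * s + 1).choose (s + 2) +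
      ∑ A ∈ powersetCard s (Icc 1 (2 * s + 1)), traceWeight F s A := by
  set U := Icc 1 (2 * s + 1) with hU
  have hcU : #U = s + (s + 1) := by rw [hU, card_Icc_one_odd]; ring
  have hsub : powersetCard s U ∪ powersetCard (s + 1) U ∪ powersetCard (s + 2) U ⊆ U.powerset := by
    intro A hA
    simp only [mem_union, mem_powersetCard, mem_powerset] at *
    tauto
  have h2 : ∑ A ∈ powersetCard (s + 2) U, #(traceLink F U A) ≤ (2 * s + 1).choose (s + 2) := by
    have : ∀ A ∈ powersetCard (s + 2) U, #(traceLink F U A) ≤ 1 := by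
      intro A hA
      have := card_le_card (traceLink_subset hF (A := A) (c := 0)
        (by rw [(mem_powersetCard.1 hA).2]))
      simpa using this
    refine (sum_le_sum this).trans ?_
    rw [sum_const, card_powersetCard, hU, card_Icc_one_odd]
    simp
  have hdis : ∀ {a b : ℕ}, a ≠ b → Disjoint (powersetCard a U) (powersetCard b U) := by
    intro a b hab
    rw [disjoint_left]
    intro A hA hB
    rw [mem_powersetCard] at hA hB
    exact hab (hA.2.symm.trans hB.2)
  rw [card_eq_sum_traceLink F U, ← sum_subset hsub, sum_union, sum_union (hdis (by omega)),
    sum_powersetCard_sdiff hcU, ← sum_add_distrib]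
  · simp only [traceWeight, ← hU]
    omega
  · rw [disjoint_union_left]
    exact ⟨hdis (by omega), hdis (by omega)⟩
  · intro A hA hA'
    rw [mem_powerset] at hA
    rw [card_eq_zero]
    refine traceLink_eq_empty hF ?_
    simp only [mem_union, mem_powersetCard, hA, true_and] at hA'
    omega

end Families

/-! ### The families `mnkH` -/

section StarFamily

variable {m s t : ℕ}

theorem inter_Icc_of_subset {a b : Finset ℕ} {n : ℕ} (ht : t ∈ Icc 1 n)
    (ha : a ⊆ Icc 1 n \ {t}) (hb : b ⊆ Icc (n + 1) m) :
    (a ∪ b ∪ {t}) ∩ Icc 1 n = a ∪ {t} ∧ (a ∪ b ∪ {t}) \ Icc 1 n = b := by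
  have ha' : ∀ x ∈ a, x ∈ Icc 1 n := fun x hx => (mem_sdiff.1 (ha hx)).1
  have hb' : ∀ x ∈ b, x ∉ Icc 1 n := by
    intro x hx h
    have := hb hx
    simp only [mem_Icc] at *
    omega
  constructor <;> ext x <;> have h1 := ha' x <;> have h2 := hb' x <;>
    simp only [mem_inter, mem_union, mem_singleton, mem_sdiff]
  · constructor
    · tauto
    · rintro (h | rfl) <;> tauto
  · constructor
    · rintro ⟨(h | h) | rfl, h'⟩ <;> tauto
    · tauto

theorem mem_mnkH (hs : 0 < s) (ht : t ∈ Icc 1 (2 * s + 1)) (hm : 2 * s + 1 ≤ m) {f : Finset ℕ} :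
    f ∈ mnkH m (2 * s + 1) (s + 2) t ↔ f ∈ powersetCard (s + 2) (Icc 1 m) ∧
      (f ⊆ Icc 1 (2 * s + 1) ∨ t ∈ f ∧ s ≤ #(f ∩ Icc 1 (2 * s + 1))) := by
  have hUm : Icc 1 (2 * s + 1) ⊆ Icc 1 m := Icc_subset_Icc_right hm
  have hVm : Icc (2 * s + 1 + 1) m ⊆ Icc 1 m := Icc_subset_Icc_left (by omega)
  simp only [mnkH, mem_union, mem_biUnion, mem_image₂, mem_powersetCard]
  constructor
  · rintro (⟨h, hc⟩ | ⟨i, hi, a, ⟨ha, hac⟩, b, ⟨hb, hbc⟩, rfl⟩)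
    · exact ⟨⟨h.trans hUm, hc⟩, Or.inl h⟩
    · obtain ⟨h1, h2⟩ := inter_Icc_of_subset ht ha hb
      have hta : t ∉ a := fun h => by simpa using ha h
      have hcard : #(a ∪ {t}) = #a + 1 := by
        rw [card_union_of_disjoint (by simpa using hta), card_singleton]
      have h3 := card_sdiff_add_card_inter (a ∪ b ∪ {t}) (Icc 1 (2 * s + 1))
      rw [mem_Icc] at hi
      rw [h1, h2, hcard] at h3
      refine ⟨⟨?_, by omega⟩, Or.inr ⟨by simp, by rw [h1]; omega⟩⟩
      refine union_subset (union_subset ((ha.trans sdiff_subset).trans hUm) (hb.trans hVm)) ?_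
      exact singleton_subset_iff.2 (hUm ht)
  · rintro ⟨⟨hf, hfc⟩, h⟩
    by_cases hfU : f ⊆ Icc 1 (2 * s + 1)
    · exact Or.inl ⟨hfU, hfc⟩
    · right
      obtain ⟨htf, hs⟩ := h.resolve_left hfU
      have hne : (f \ Icc 1 (2 * s + 1)).Nonempty := sdiff_nonempty.2 hfU
      have hpos := hne.card_pos
      have h3 := card_sdiff_add_card_inter f (Icc 1 (2 * s + 1))
      have htU : t ∈ f ∩ Icc 1 (2 * s + 1) := mem_inter.2 ⟨htf, ht⟩
      refine ⟨#(f \ Icc 1 (2 * s + 1)), by rw [mem_Icc]; omega,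
        (f ∩ Icc 1 (2 * s + 1)) \ {t}, ⟨sdiff_subset_sdiff inter_subset_right subset_rfl, ?_⟩,
        f \ Icc 1 (2 * s + 1), ⟨?_, rfl⟩, ?_⟩
      · rw [card_sdiff_of_subset (singleton_subset_iff.2 htU), card_singleton]; omega
      · intro x hx
        rw [mem_sdiff] at hx
        have h1 := hf hx.1
        have h2 := hx.2
        simp only [mem_Icc] at *
        omega
      · ext x
        simp only [mem_union, mem_sdiff, mem_inter, mem_singleton]
        by_cases hx : x = t
        · subst hx; tauto
        · tauto

theorem isMNKIntersecting_mnkH (hs : 0 < s) (ht : t ∈ Icc 1 (2 * s + 1)) (hm : 2 * s + 1 ≤ m) :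
    IsMNKIntersecting m (2 * s + 1) (s + 2) (mnkH m (2 * s + 1) (s + 2) t) := by
  have key : ∀ f g : Finset ℕ, f ⊆ Icc 1 (2 * s + 1) → #f = s + 2 →
      s ≤ #(g ∩ Icc 1 (2 * s + 1)) → ¬ Disjoint f g := by
    intro f g hf hfc hg hd
    have h1 : Disjoint f (g ∩ Icc 1 (2 * s + 1)) := hd.mono_right inter_subset_left
    have h2 := card_le_card (union_subset hf (inter_subset_right (s₁ := g)))
    rw [card_union_of_disjoint h1, Nat.card_Icc] at h2
    omega
  have hge : ∀ f ∈ mnkH m (2 * s + 1) (s + 2) t, s ≤ #(f ∩ Icc 1 (2 * s + 1)) := by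
    intro f hf
    rw [mem_mnkH hs ht hm, mem_powersetCard] at hf
    rcases hf.2 with h | h
    · rw [inter_eq_left.2 h]; omega
    · exact h.2
  refine ⟨subset_union_left, fun f hf => ((mem_mnkH hs ht hm).1 hf).1, ?_⟩
  intro f hf g hg hd
  have hf' := (mem_mnkH hs ht hm).1 hf
  have hg' := (mem_mnkH hs ht hm).1 hg
  rcases hf'.2 with h | h
  · exact key f g h (mem_powersetCard.1 hf'.1).2 (hge g hg) hd
  · rcases hg'.2 with h' | h'
    · exact key g f h' (mem_powersetCard.1 hg'.1).2 (hge f hf) hd.symm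
    · exact disjoint_left.1 hd h.1 h'.1

theorem card_mnkH {n k : ℕ} (ht : t ∈ Icc 1 n) : #(mnkH m n k t) = mnkh m n k := by
  have htr : ∀ i, ∀ f ∈ image₂ (fun A B => A ∪ B ∪ {t})
      (powersetCard (k - i - 1) (Icc 1 n \ {t})) (powersetCard i (Icc (n + 1) m)),
      #(f \ Icc 1 n) = i := by
    intro i f hf
    obtain ⟨a, ha, b, hb, rfl⟩ := mem_image₂.1 hf
    rw [mem_powersetCard] at ha hb
    rw [(inter_Icc_of_subset ht ha.1 hb.1).2, hb.2]
  rw [mnkH, mnkh, card_union_of_disjoint, card_biUnion]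
  · rw [card_powersetCard, Nat.card_Icc, Nat.add_sub_cancel]
    congr 1
    refine sum_congr rfl fun i _ => ?_
    rw [card_image₂_iff.2, card_powersetCard, card_powersetCard, Nat.card_Icc,
      card_sdiff_of_subset (singleton_subset_iff.2 ht), Nat.card_Icc, card_singleton,
      Nat.add_sub_cancel, Nat.add_sub_add_right]
    rintro ⟨a, b⟩ hab ⟨a', b'⟩ hab' h
    simp only [Set.mem_prod, mem_coe, mem_powersetCard] at hab hab'
    simp only at h
    obtain ⟨h1, h2⟩ := inter_Icc_of_subset ht hab.1.1 hab.2.1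
    obtain ⟨h1', h2'⟩ := inter_Icc_of_subset ht hab'.1.1 hab'.2.1
    have hta : t ∉ a := fun h => by simpa using hab.1.1 h
    have hta' : t ∉ a' := fun h => by simpa using hab'.1.1 h
    rw [h, h1'] at h1
    rw [h, h2'] at h2
    have : a = a' := by
      ext x
      have := congrArg (x ∈ ·) h1
      simp only [mem_union, mem_singleton, eq_iff_iff] at this
      by_cases hx : x = t
      · subst hx; tauto
      · tauto
    rw [this, h2]
  · intro i _ j _ hij
    rw [Function.onFun, disjoint_left]
    intro f hf hf'
    exact hij ((htr i f hf).symm.trans (htr j f hf'))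
  · rw [disjoint_left]
    intro f hf hf'
    obtain ⟨i, hi, hfi⟩ := mem_biUnion.1 hf'
    have := htr i f hfi
    rw [sdiff_eq_empty_iff_subset.2 (mem_powersetCard.1 hf).1, card_empty] at this
    rw [mem_Icc] at hi
    omega

theorem mnkh_odd (m s : ℕ) : mnkh m (2 * s + 1) (s + 2) = (2 * s + 1).choose (s + 2) +
    ((2 * s).choose s * (m - (2 * s + 1)) +
      (2 * s).choose (s - 1) * (m - (2 * s + 1)).choose 2) := by
  have h : Icc 1 (2 * (s + 2) - (2 * s + 1) - 1) = {1, 2} := by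
    rw [show 2 * (s + 2) - (2 * s + 1) - 1 = 2 by omega]; rfl
  rw [mnkh, h, sum_pair (by norm_num), Nat.choose_one_right]
  rfl

end StarFamily

/-! ### The extremal theorem -/

section Extremal

variable {m s : ℕ} {F : Finset (Finset ℕ)}

theorem card_le_and_subset_mnkH (hs : 0 < s) (hm : 2 * s + 5 ≤ m)
    (hF : IsMNKIntersecting m (2 * s + 1) (s + 2) F) :
    #F ≤ mnkh m (2 * s + 1) (s + 2) ∧ (#F = mnkh m (2 * s + 1) (s + 2) →
      ∃ t ∈ Icc 1 (2 * s + 1), F ⊆ mnkH m (2 * s + 1) (s + 2) t) := by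
  set U := Icc 1 (2 * s + 1) with hU
  set V := Icc (2 * s + 1 + 1) m with hV
  have hcU : #U = 2 * s + 1 := card_Icc_one_odd s
  have hcV : #V = m - (2 * s + 1) := by rw [hV, Nat.card_Icc]; omega
  have hV4 : 4 ≤ #V := by omega
  set T := powersetCard s U with hT
  have hcT : #T = (2 * s).choose (s - 1) + (2 * s).choose s := by
    obtain ⟨r, rfl⟩ : ∃ r, s = r + 1 := ⟨s - 1, by omega⟩
    rw [hT, card_powersetCard, hcU, Nat.choose_succ_succ, Nat.add_sub_cancel]
  have hE : ∀ A ∈ T, traceLink F U A ⊆ powersetCard 2 V := fun A hA =>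
    traceLink_subset hF (by rw [(mem_powersetCard.1 hA).2])
  have hG : ∀ A ∈ T, traceLink F U (U \ A) ⊆ powersetCard 1 V := fun A hA =>
    traceLink_subset hF (by
      rw [card_sdiff_of_subset (mem_powersetCard.1 hA).1, (mem_powersetCard.1 hA).2, hcU]; omega)
  have hEG : ∀ A, ∀ e ∈ traceLink F U A, ∀ g ∈ traceLink F U (U \ A), ¬ Disjoint e g :=
    fun A e he g hg => not_disjoint_of_mem_traceLink hF.2.2 disjoint_sdiff he hg
  -- `J` is the family of heavy sets.
  set J := T.filter fun A => #V < traceWeight F s A with hJ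
  have hJI : (J : Set (Finset ℕ)).Intersecting := by
    intro A hA B hB hAB
    obtain ⟨hAT, hA⟩ := mem_filter.1 hA
    obtain ⟨hBT, hB⟩ := mem_filter.1 hB
    rcases card_add_card_le_of_cross_intersecting hV4 (hE A hAT) (hE B hBT) (hG A hAT) (hG B hBT)
      (hEG A) (hEG B) (fun e he f hf => not_disjoint_of_mem_traceLink hF.2.2 hAB he hf) with h | h
    · exact hA.not_ge h
    · exact hB.not_ge h
  obtain ⟨hJle, hJeq⟩ := intersecting_powersetCard_odd hs hcU (filter_subset _ _) hJI
  have hGJ : ∀ A ∈ J, traceLink F U (U \ A) = ∅ := by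
    intro A hA
    obtain ⟨hAT, hA⟩ := mem_filter.1 hA
    refine eq_empty_of_disjoint_pairs (hG A hAT) (hEG A) fun hI => ?_
    exact hA.not_ge (card_add_card_le_of_intersecting hV4 (hE A hAT) (hG A hAT) (hEG A) hI)
  have hwJ : ∀ A ∈ J, traceWeight F s A = #(traceLink F U A) := by
    intro A hA
    rw [traceWeight, ← hU, hGJ A hA, card_empty, add_zero]
  have hwJle : ∀ A ∈ J, traceWeight F s A ≤ (#V).choose 2 := by
    intro A hA
    rw [hwJ A hA, ← card_powersetCard]
    exact card_le_card (hE A (mem_filter.1 hA).1)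
  have hwle : ∀ A ∈ T.filter (fun A => ¬ #V < traceWeight F s A), traceWeight F s A ≤ #V :=
    fun A hA => not_lt.1 (mem_filter.1 hA).2
  have hFle := card_le_add_sum_traceWeight hF
  rw [← hU, ← hT, ← sum_filter_add_sum_filter_not T (fun A => #V < traceWeight F s A)] at hFle
  rw [← hJ] at hFle
  have hsplit := card_filter_add_card_filter_not (s := T) (fun A => #V < traceWeight F s A)
  rw [← hJ, hcT] at hsplit
  have hs1 := sum_le_sum hwJle
  have hs2 := sum_le_sum hwle
  rw [sum_const, smul_eq_mul] at hs1 hs2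
  have hlt := lt_choose_two hV4
  obtain ⟨d, hd⟩ : ∃ d, (#V).choose 2 = #V + (d + 1) := ⟨(#V).choose 2 - #V - 1, by omega⟩
  rw [mnkh_odd, ← hcV]
  set a := (2 * s).choose (s - 1)
  set b := (2 * s).choose s
  set j := #J
  set j' := #(T.filter fun A => ¬ #V < traceWeight F s A)
  set N := #V
  -- Each heavy set short of the maximum number `a` costs `C(N,2) - N = d + 1 > 0`, so equality will
  -- force `j = a`.
  have hbound : j * N.choose 2 + j' * N + (a - j) * (d + 1) = b * N + a * N.choose 2 := by
    obtain ⟨c, hc⟩ : ∃ c, a = j + c := ⟨a - j, by omega⟩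
    have : j' = c + b := by omega
    rw [hc, Nat.add_sub_cancel_left, this, hd]; ring
  refine ⟨by omega, fun heq => ?_⟩
  have haj : a - j = 0 := by
    by_contra hne
    have : 0 < (a - j) * (d + 1) := Nat.mul_pos (by omega) (by omega)
    omega
  have hcJ : #J = a := by omega
  have hsum : ∑ A ∈ J, traceWeight F s A = ∑ _A ∈ J, N.choose 2 := by
    rw [sum_const, smul_eq_mul]
    rw [haj, zero_mul] at hbound
    change _ = j * N.choose 2
    omega
  have hfull : ∀ A ∈ J, traceLink F U A = powersetCard 2 V := by
    intro A hA
    refine eq_of_subset_of_card_le (hE A (mem_filter.1 hA).1) ?_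
    rw [card_powersetCard, ← hwJ A hA, (sum_eq_sum_iff_of_le hwJle).1 hsum A hA]
  obtain ⟨t, htU, ht⟩ := hJeq hcJ
  have hJstar : J = T.filter fun A => t ∈ A := by
    refine eq_of_subset_of_card_le (fun A hA => mem_filter.2 ⟨(mem_filter.1 hA).1, ht A hA⟩) ?_
    rw [hcJ]
    have hsub : (T.filter fun A => t ∈ A) ⊆
        (powersetCard (s - 1) (U.erase t)).image (insert t) := by
      intro A hA
      obtain ⟨hA, htA⟩ := mem_filter.1 hA
      obtain ⟨hAU, hAs⟩ := mem_powersetCard.1 hA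
      refine mem_image.2 ⟨A.erase t, mem_powersetCard.2 ⟨erase_subset_erase t hAU, ?_⟩,
        insert_erase htA⟩
      rw [card_erase_of_mem htA, hAs]
    refine (card_le_card hsub).trans (card_image_le.trans ?_)
    rw [card_powersetCard, card_erase_of_mem htU, hcU, Nat.add_sub_cancel]
  -- Some `s`-set `B` containing `t` is disjoint from `A`. Its link is the complete graph on `V`,
  -- and no pair meets all pairs once `|V| ≥ 4`.
  have hempty : ∀ A ∈ T, t ∉ A → traceLink F U A = ∅ := by
    intro A hA htA
    obtain ⟨hAU, hAs⟩ := mem_powersetCard.1 hA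
    have h1 : s ≤ #(U \ A) := by rw [card_sdiff_of_subset hAU]; omega
    obtain ⟨B, htB, hB, hBs⟩ := exists_subsuperset_card_eq
      (singleton_subset_iff.2 (mem_sdiff.2 ⟨htU, htA⟩)) (by rw [card_singleton]; exact hs) h1
    have hBJ : B ∈ J := by
      rw [hJstar]
      exact mem_filter.2 ⟨mem_powersetCard.2 ⟨hB.trans sdiff_subset, hBs⟩,
        singleton_subset_iff.1 htB⟩
    refine eq_empty_of_cross_intersecting_powersetCard hV4 (hE A hA) fun e he f hf => ?_
    rw [← hfull B hBJ] at hf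
    exact not_disjoint_of_mem_traceLink hF.2.2 (disjoint_sdiff.mono_right hB) he hf
  refine ⟨t, htU, fun f hf => ?_⟩
  have hfm := hF.2.1 hf
  obtain ⟨-, hfc⟩ := mem_powersetCard.1 hfm
  rw [mem_mnkH hs htU (by omega)]
  refine ⟨hfm, or_iff_not_imp_left.2 fun hfU => ?_⟩
  have hge := le_card_inter_of_mem hF hf
  refine ⟨?_, hge⟩
  rw [← hU] at hge hfU
  have hmem : f \ U ∈ traceLink F U (f ∩ U) := mem_traceLink.2 ⟨f, hf, rfl, rfl⟩
  have hne := (sdiff_nonempty.2 hfU).card_pos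
  have hcf := card_sdiff_add_card_inter f U
  by_contra htf
  -- A trace of size `s+1` avoiding `t` is the complement of a heavy set, so its link is empty by
  -- `hGJ`; a trace of size `s` avoiding `t` is excluded by `hempty`.
  rcases Nat.lt_or_ge s #(f ∩ U) with h | h
  · have hfI : #(f ∩ U) = s + 1 := by omega
    have hA : U \ (f ∩ U) ∈ T := by
      refine mem_powersetCard.2 ⟨sdiff_subset, ?_⟩
      rw [card_sdiff_of_subset inter_subset_right]; omega
    have hAJ : U \ (f ∩ U) ∈ J := by
      rw [hJstar]
      exact mem_filter.2 ⟨hA, by simp [htU, htf]⟩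
    have := hGJ _ hAJ
    rw [Finset.sdiff_sdiff_eq_self inter_subset_right] at this
    rw [this] at hmem
    simp at hmem
  · have hA : f ∩ U ∈ T := mem_powersetCard.2 ⟨inter_subset_right, by omega⟩
    rw [hempty _ hA (by simp [htf])] at hmem
    simp at hmem

end Extremal

/-! ### The theorem for `n = 2k - 3` -/

theorem theorem11 (m n k : ℕ) (hkn : k ≤ n) (hkm : 2 * k < m) (hn : n + 3 = 2 * k) :
    mnkAlpha m n k = mnkh m n k ∧
      ∀ F : Finset (Finset ℕ), IsMaximumMNK m n k F → ∃ t ∈ Icc 1 n, F = mnkH m n k t := by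
  obtain ⟨s, rfl⟩ : ∃ s, k = s + 2 := ⟨k - 2, by omega⟩
  obtain rfl : n = 2 * s + 1 := by omega
  have hs : 0 < s := by omega
  have hm : 2 * s + 5 ≤ m := by omega
  have hα : mnkAlpha m (2 * s + 1) (s + 2) = mnkh m (2 * s + 1) (s + 2) := by
    classical
    apply le_antisymm
    · refine Finset.sup_le fun F hF => ?_
      exact (card_le_and_subset_mnkH hs hm (mem_filter.1 hF).2).1
    · have h1 : 1 ∈ Icc 1 (2 * s + 1) := by simp
      have hH := isMNKIntersecting_mnkH (m := m) hs h1 (by omega)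
      rw [← card_mnkH (m := m) h1, mnkAlpha]
      refine le_sup (f := card) ?_
      rw [mem_filter, mem_powerset]
      exact ⟨hH.2.1, hH⟩
  refine ⟨hα, fun F hF => ?_⟩
  have hcF : #F = mnkh m (2 * s + 1) (s + 2) := hF.2.trans hα
  obtain ⟨t, ht, hsub⟩ := (card_le_and_subset_mnkH hs hm hF.1).2 hcF
  exact ⟨t, ht, eq_of_subset_of_card_le hsub (by rw [card_mnkH ht, hcF])⟩
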